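/- All graphs are finite, undirected and simple. A path decomposition of a graph $G$ is a collection of pairwise edge-disjoint paths in $G$ that covers all the edges of $G$; let $p(G)$ denote the minimum number of paths in a path decomposition of $G$. The Cartesian product $G\Box H$ is the graph with vertex set $V(G)\times V(H)$ in which $(u_1,v_1)$ and $(u_2,v_2)$ are adjacent if and only if either $u_1u_2\in E(G)$ and $v_1=v_2$, or $v_1v_2\in E(H)$ and $u_1=u_2$. Let $T$ be a tree of order (number of vertices) $m\geq 2$ and let $H$ be a connected graph of order $n$. Then $p(T\Box H)\leq \frac{mn}{2}$. -/

import Mathlib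

namespace SimpleGraph

/-- A subgraph of `G` is a path if it consists of the vertices and edges traversed by some walk
of `G` without repeated vertices. -/
def Subgraph.IsPathGraph {V : Type*} {G : SimpleGraph V} (P : G.Subgraph) : Prop :=
  ∃ (u v : V) (w : G.Walk u v), w.IsPath ∧ w.toSubgraph = P

/-- A path decomposition of `G`: a finite collection of pairwise edge-disjoint paths of `G` that
covers all the edges of `G`. -/
structure IsPathDecomposition {V : Type*} (G : SimpleGraph V) (D : Finset G.Subgraph) : Prop where
  isPath : ∀ P ∈ D, P.IsPathGraph
  edgeDisjoint : ∀ P ∈ D, ∀ Q ∈ D, P ≠ Q → Disjoint P.edgeSet Q.edgeSet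
  covers : ∀ e ∈ G.edgeSet, ∃ P ∈ D, e ∈ P.edgeSet

/-- `p(G)`: the minimum number of paths in a path decomposition of `G`. For a finite graph the
minimum is attained, see `isLeast_pathDecompositionNumber`. -/
noncomputable def pathDecompositionNumber {V : Type*} (G : SimpleGraph V) : ℕ :=
  sInf {k : ℕ | ∃ D : Finset G.Subgraph, G.IsPathDecomposition D ∧ D.card = k}

theorem exists_isPathDecomposition {V : Type*} [Finite V] (G : SimpleGraph V) :
    ∃ D : Finset G.Subgraph, G.IsPathDecomposition D := by
  classical
  have hfin : {P : G.Subgraph | ∃ (u v : V) (h : G.Adj u v), P = G.subgraphOfAdj h}.Finite :=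
    Set.toFinite _
  refine ⟨hfin.toFinset, ?_, ?_, ?_⟩
  · intro P hP
    obtain ⟨u, v, h, rfl⟩ := hfin.mem_toFinset.1 hP
    exact ⟨u, v, h.toWalk, Walk.IsPath.of_adj h, by simp⟩
  · intro P hP Q hQ hne
    obtain ⟨u, v, h, rfl⟩ := hfin.mem_toFinset.1 hP
    obtain ⟨u', v', h', rfl⟩ := hfin.mem_toFinset.1 hQ
    rw [Set.disjoint_left]
    intro e he he'
    simp only [edgeSet_subgraphOfAdj, Set.mem_singleton_iff] at he he'
    apply hne
    have huv : s(u, v) = s(u', v') := he.symm.trans he'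
    rcases Sym2.eq_iff.1 huv with ⟨rfl, rfl⟩ | ⟨rfl, rfl⟩
    · rfl
    · exact subgraphOfAdj_symm h'
  · intro e
    induction e with
    | _ u v =>
      intro he
      have h : G.Adj u v := he
      exact ⟨G.subgraphOfAdj h, hfin.mem_toFinset.2 ⟨u, v, h, rfl⟩,
        by rw [edgeSet_subgraphOfAdj]; exact Set.mem_singleton _⟩

theorem isLeast_pathDecompositionNumber {V : Type*} [Finite V] (G : SimpleGraph V) :
    IsLeast {k : ℕ | ∃ D : Finset G.Subgraph, G.IsPathDecomposition D ∧ D.card = k}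
      G.pathDecompositionNumber := by
  obtain ⟨D, hD⟩ := G.exists_isPathDecomposition
  exact ⟨Nat.sInf_mem ⟨D.card, D, hD, rfl⟩, fun k hk => Nat.sInf_le hk⟩

end SimpleGraph

/-! Write `n` for the order of `H`. By Lovász's theorem `H` splits into paths with at most two ends
at each vertex. The multigraph joining the two ends of each path has maximum degree two, so the
paths can be directed with each vertex starting at most one and finishing at most one. Trivial paths
at the vertices that start none then give one path `Q w` from every `w`, with at most two finishing
at any vertex (`exists_rooted_paths`).

Being a forest, `T` splits into nontrivial paths, at most one ending at each vertex
(`exists_forest_paths`). Charge every vertex of `T` to one of these paths through it: to the one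
ending there, if any. A path `R` charged with the set `S` has both its ends in `S`.

For each `R`, run `n` strands along the copies of `R`. They begin by traversing every `Q w`
backwards in the first copy of `H`, so exactly one arrives at each vertex of that copy. All then
step along `R`; in a copy charged to `R`, the strand entering at `w` follows `Q w`. Afterwards at
most two strands finish at each vertex, so at least `n/2` vertices are reached: one strand per
reached vertex continues, trivial strands start elsewhere, and at most `n/2` strands stop
(`exists_recycle`). In the last copy all `n` stop. Thus `R` costs at most `n + (|S| - 2) * n/2 = |S|
* n/2` paths, and the sets `S` partition the vertices of `T`.

Lovász's theorem is proved by inserting edges one at a time; the engine is `exists_add_edge`. -/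

namespace PathFamily

/-! ### Paths as vertex lists: edges and ends -/

variable {V W X : Type*}

/-- The edges between consecutive entries of a list. -/
def pathEdges : List V → Multiset (Sym2 V)
  | [] => 0
  | [_] => 0
  | a :: b :: l => s(a, b) ::ₘ pathEdges (b :: l)

@[simp] theorem pathEdges_nil : pathEdges ([] : List V) = 0 := rfl

@[simp] theorem pathEdges_singleton (a : V) : pathEdges [a] = 0 := rfl

@[simp] theorem pathEdges_cons_cons (a b : V) (l : List V) :
    pathEdges (a :: b :: l) = s(a, b) ::ₘ pathEdges (b :: l) := rfl

theorem pathEdges_append (l : List V) (a b : V) (r : List V) :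
    pathEdges ((l ++ [a]) ++ (b :: r)) = pathEdges (l ++ [a]) + s(a, b) ::ₘ pathEdges (b :: r) := by
  induction l with
  | nil => simp
  | cons c l ih =>
    cases l with
    | nil => simp [Multiset.cons_swap]
    | cons d l =>
      simp only [List.cons_append, pathEdges_cons_cons] at ih ⊢
      rw [ih, Multiset.cons_add]

theorem pathEdges_append_of_getLast? {l : List V} {a : V} (h : l.getLast? = some a) (b : V)
    (r : List V) :
    pathEdges (l ++ b :: r) = pathEdges l + s(a, b) ::ₘ pathEdges (b :: r) := by
  obtain ⟨l', rfl⟩ := List.getLast?_eq_some_iff.1 h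
  exact pathEdges_append l' a b r

@[simp] theorem pathEdges_reverse (l : List V) : pathEdges l.reverse = pathEdges l := by
  induction l with
  | nil => rfl
  | cons a l ih =>
    cases l with
    | nil => rfl
    | cons b l =>
      rw [List.reverse_cons, pathEdges_append_of_getLast? (a := b) (by simp), ih, pathEdges_cons_cons,
        Sym2.eq_swap]
      simp [add_comm, ← Multiset.singleton_add]

theorem pathEdges_map (f : V → W) (l : List V) :
    pathEdges (l.map f) = (pathEdges l).map (Sym2.map f) := by
  induction l with
  | nil => rfl
  | cons a l ih =>
    cases l with
    | nil => rfl
    | cons b l => simpa using ih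

theorem mem_of_mem_pathEdges {l : List V} {e : Sym2 V} (he : e ∈ pathEdges l) {v : V}
    (hv : v ∈ e) : v ∈ l := by
  induction l with
  | nil => simp at he
  | cons a l ih =>
    cases l with
    | nil => simp at he
    | cons b l =>
      rw [pathEdges_cons_cons, Multiset.mem_cons] at he
      rcases he with rfl | he
      · rcases Sym2.mem_iff.1 hv with rfl | rfl <;> simp
      · exact List.mem_cons_of_mem _ (ih he)

section Ends

variable [DecidableEq V]

/-- The number of ends (zero, one or two) of the path `l` at `v`; a one-vertex path has two
ends at its vertex. -/
def endCount (v : V) (l : List V) : ℕ :=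
  (if l.head? = some v then 1 else 0) + (if l.getLast? = some v then 1 else 0)

@[simp] theorem endCount_reverse (v : V) (l : List V) : endCount v l.reverse = endCount v l := by
  simp [endCount, Nat.add_comm]

theorem mem_of_endCount_pos {v : V} {l : List V} (h : 0 < endCount v l) : v ∈ l := by
  unfold endCount at h
  split_ifs at h with h1 h2 h2
  · exact List.mem_of_mem_head? h1
  · exact List.mem_of_mem_head? h1
  · exact List.mem_of_mem_getLast? h2
  · simp at h

theorem head?_or_reverse_of_endCount_pos {v : V} {l : List V} (h : 0 < endCount v l) :
    ∃ r, (l = v :: r ∨ l.reverse = v :: r) := by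
  unfold endCount at h
  by_cases h1 : l.head? = some v
  · obtain ⟨r, rfl⟩ := List.head?_eq_some_iff.1 h1
    exact ⟨r, Or.inl rfl⟩
  · by_cases h2 : l.getLast? = some v
    · obtain ⟨r, hr⟩ := List.head?_eq_some_iff.1 ((List.head?_reverse (l := l)).trans h2)
      exact ⟨r, Or.inr hr⟩
    · simp [h1, h2] at h

end Ends

/-- All edges traversed by the members of a family of paths. -/
def edges (M : Multiset (List V)) : Multiset (Sym2 V) := (M.map pathEdges).sum

/-- The number of ends at `v` of the members of a family of paths. -/
def ends [DecidableEq V] (M : Multiset (List V)) (v : V) : ℕ := (M.map (endCount v)).sum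

@[simp] theorem edges_zero : edges (0 : Multiset (List V)) = 0 := rfl

@[simp] theorem edges_cons (l : List V) (M : Multiset (List V)) :
    edges (l ::ₘ M) = pathEdges l + edges M := by simp [edges]

@[simp] theorem edges_add (M N : Multiset (List V)) : edges (M + N) = edges M + edges N := by
  simp [edges]

theorem mem_edges {M : Multiset (List V)} {e : Sym2 V} :
    e ∈ edges M ↔ ∃ l ∈ M, e ∈ pathEdges l := by
  induction M using Multiset.induction_on with
  | empty => simp
  | cons l M ih => simp [ih]

section Ends

variable [DecidableEq V]

@[simp] theorem ends_zero (v : V) : ends (0 : Multiset (List V)) v = 0 := rfl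

@[simp] theorem ends_cons (l : List V) (M : Multiset (List V)) (v : V) :
    ends (l ::ₘ M) v = endCount v l + ends M v := by simp [ends]

@[simp] theorem ends_add (M N : Multiset (List V)) (v : V) :
    ends (M + N) v = ends M v + ends N v := by simp [ends]

theorem exists_of_ends_pos {M : Multiset (List V)} {v : V} (h : 0 < ends M v) :
    ∃ l ∈ M, 0 < endCount v l := by
  induction M using Multiset.induction_on with
  | empty => simp at h
  | cons l M ih =>
    rw [ends_cons] at h
    by_cases hl : 0 < endCount v l
    · exact ⟨l, by simp, hl⟩
    · obtain ⟨l', h1, h2⟩ := ih (by omega)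
      exact ⟨l', by simp [h1], h2⟩

/-! ### Inserting an edge by moving one end -/

/-- `l'` is a path on the vertices of `l` and possibly `a`, and ends in `a` if `l` does. -/
def Reroutes (a : V) (l l' : List V) : Prop :=
  l'.Nodup ∧ l' ≠ [] ∧ (∀ v, v ≠ a → (v ∈ l' ↔ v ∈ l)) ∧
    (0 < endCount a l → 0 < endCount a l')

/-- If `x` and all neighbours of `a` are ends of paths of an edge-disjoint family, then the edge
`xa` can be added at the cost of moving one end from `x` to `a`. -/
theorem exists_add_edge {x a : V} (M : Multiset (List V)) (hM : ∀ l ∈ M, l.Nodup ∧ l ≠ [])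
    (hE : (edges M).Nodup) (hxa : x ≠ a) (hnew : s(x, a) ∉ edges M)
    (hends : ∀ z, z = x ∨ s(z, a) ∈ edges M → 0 < ends M z) :
    ∃ M', Multiset.Rel (Reroutes a) M M' ∧ edges M' = s(x, a) ::ₘ edges M ∧
      ∀ v, ends M' v + (if v = x then 1 else 0) = ends M v + (if v = a then 1 else 0) := by
  induction hn : (M.map List.length).sum using Nat.strong_induction_on generalizing M x with
  | _ n ih =>
  obtain ⟨l, hlM, hlx⟩ := exists_of_ends_pos (hends x (Or.inl rfl))
  obtain ⟨M₀, rfl⟩ := Multiset.exists_cons_of_mem hlM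
  obtain ⟨tl, htl⟩ := head?_or_reverse_of_endCount_pos hlx
  have hl := hM l (by simp)
  have hlen : (x :: tl).length = l.length := by
    rcases htl with h | h <;> rw [← h]; simp
  have hnd : (x :: tl).Nodup := by
    rcases htl with h | h <;> rw [← h]
    · exact hl.1
    · exact List.nodup_reverse.2 hl.1
  have hmem : ∀ v, v ∈ x :: tl ↔ v ∈ l := by
    intro v
    rcases htl with h | h <;> rw [← h]; simp
  have hpe : pathEdges l = pathEdges (x :: tl) := by
    rcases htl with h | h <;> rw [← h]; simp
  have hec : ∀ v, endCount v l = endCount v (x :: tl) := by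
    intro v
    rcases htl with h | h <;> rw [← h]; simp
  have hrefl : ∀ N : Multiset (List V), (∀ l ∈ N, l ∈ M₀) → Multiset.Rel (Reroutes a) N N :=
    fun N hN => Multiset.rel_refl_of_refl_on fun l hl =>
      ⟨(hM l (by simp [hN l hl])).1, (hM l (by simp [hN l hl])).2, fun _ _ => Iff.rfl, id⟩
  by_cases ha : a ∈ x :: tl
  -- The path from `x` already meets `a`, so `xa` would close a cycle. Write it as `x … z a R`,
  -- detach the segment `x … z`, drop the edge `za`, and reinsert `za` by induction into the shorter
  -- family. Neighbours of `a` there differ from `x`, since `xa` is new, so they keep their ends.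
  · obtain ⟨L, R, hLR⟩ := List.mem_iff_append.1 ha
    obtain ⟨L₁, rfl⟩ : ∃ L₁, L = x :: L₁ := by
      cases L with
      | nil => simp at hLR; exact absurd hLR.1 hxa
      | cons y L => simp at hLR; exact ⟨L, by rw [hLR.1]⟩
    obtain ⟨z, hz⟩ : ∃ z, (x :: L₁).getLast? = some z := by
      rw [← Option.isSome_iff_exists]; simp
    have hzL : z ∈ x :: L₁ := List.mem_of_mem_getLast? hz
    rw [hLR] at hnd hmem hpe hec hlen
    have hnd' := List.nodup_append'.1 hnd
    have hdisj : ∀ v ∈ x :: L₁, v ∉ a :: R := fun v h1 h2 => hnd'.2.2 h1 h2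
    have hza : z ≠ a := fun h => hdisj z hzL (by simp [h])
    have hpe' : pathEdges l = pathEdges (x :: L₁) + s(z, a) ::ₘ pathEdges (a :: R) := by
      rw [hpe, pathEdges_append_of_getLast? hz]
    have hEold : edges (l ::ₘ M₀) =
        s(z, a) ::ₘ (pathEdges (x :: L₁) + edges ((a :: R) ::ₘ M₀)) := by
      rw [edges_cons, edges_cons, hpe']
      simp only [Multiset.cons_add, Multiset.add_cons, add_assoc]
    have hzx : s(z, a) ∈ edges (l ::ₘ M₀) := by rw [hEold]; simp
    have hlast : (x :: L₁ ++ a :: R).getLast? = (a :: R).getLast? :=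
      List.getLast?_append_of_ne_nil _ (by simp)
    have hendl : ∀ v, ends (l ::ₘ M₀) v + (if v = a then 1 else 0) =
        ends ((a :: R) ::ₘ M₀) v + (if v = x then 1 else 0) := by
      intro v
      rw [ends_cons, ends_cons, hec]
      unfold endCount
      rw [hlast]
      simp only [List.cons_append, List.head?_cons, Option.some.injEq, eq_comm (a := v)]
      omega
    rw [hEold, Multiset.nodup_cons] at hE
    obtain ⟨M', hrel, hedge, hend⟩ := ih _ (by
        rw [← hn]
        simp only [Multiset.map_cons, Multiset.sum_cons]
        simp only [List.length_append, List.length_cons] at hlen ⊢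
        omega) (x := z) ((a :: R) ::ₘ M₀)
      (by
        intro l' hl'
        rcases Multiset.mem_cons.1 hl' with rfl | hl'
        · exact ⟨hnd'.2.1, by simp⟩
        · exact hM l' (by simp [hl']))
      ((Multiset.nodup_add.1 hE.2).2.1) hza
      (fun h => hE.1 (Multiset.mem_add.2 (Or.inr h)))
      (by
        intro y hy
        have hyE : s(y, a) ∈ edges (l ::ₘ M₀) := by
          rcases hy with rfl | hy
          · exact hzx
          · rw [hEold]; exact Multiset.mem_cons_of_mem (Multiset.mem_add.2 (Or.inr hy))
        have h1 := hends y (Or.inr hyE)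
        have hyx : y ≠ x := fun h => hnew (h ▸ hyE)
        have h2 := hendl y
        rw [if_neg hyx] at h2
        omega) rfl
    -- The rerouted image `b` of `a :: R` still ends in `a` and gains no vertex of the detached
    -- segment. Hence the segment can be glued back reversed, as `z … x a R'`, which uses the edge
    -- `xa`.
    obtain ⟨b, M₁, hb, hM₁, rfl⟩ := Multiset.rel_cons_left.1 hrel
    obtain ⟨R', hR'⟩ := head?_or_reverse_of_endCount_pos (hb.2.2.2 (by simp [endCount]))
    have hbnd : (a :: R').Nodup := by
      rcases hR' with h | h <;> rw [← h]
      · exact hb.1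
      · exact List.nodup_reverse.2 hb.1
    have hbmem : ∀ v, v ≠ a → (v ∈ a :: R' ↔ v ∈ a :: R) := by
      intro v hv
      rw [← hb.2.2.1 v hv]
      rcases hR' with h | h <;> rw [← h]; simp
    have hbpe : pathEdges b = pathEdges (a :: R') := by
      rcases hR' with h | h <;> rw [← h]; simp
    have hbec : ∀ v, endCount v b = endCount v (a :: R') := by
      intro v
      rcases hR' with h | h <;> rw [← h]; simp
    have hdisj' : ∀ v ∈ x :: L₁, v ∉ a :: R' := by
      intro v h1 h2
      by_cases hva : v = a
      · exact hdisj v h1 (by simp [hva])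
      · exact hdisj v h1 ((hbmem v hva).1 h2)
    have hlast' : ((x :: L₁).reverse ++ a :: R').getLast? = (a :: R').getLast? :=
      List.getLast?_append_of_ne_nil _ (by simp)
    have hhead' : ((x :: L₁).reverse ++ a :: R').head? = some z := by
      rw [List.head?_append_of_ne_nil _ (by simp), List.head?_reverse, hz]
    refine ⟨((x :: L₁).reverse ++ a :: R') ::ₘ M₁, Multiset.rel_cons_left.2
      ⟨_, _, ⟨?_, by simp, ?_, ?_⟩, hM₁, rfl⟩, ?_, ?_⟩
    · rw [List.nodup_append']
      exact ⟨List.nodup_reverse.2 hnd'.1, hbnd, fun v h1 h2 => hdisj' v (List.mem_reverse.1 h1) h2⟩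
    · intro v hv
      rw [← hmem v, List.mem_append, List.mem_append, hbmem v hv, List.mem_reverse]
    · rw [hec]
      unfold endCount
      rw [hlast, hlast', hhead']
      simp only [List.cons_append, List.head?_cons, Option.some.injEq, hxa, if_false]
      intro h
      have hR : (a :: R).getLast? = some a := by
        by_contra hcon
        simp [hcon] at h
      have hRnil : R = [] := by
        cases R with
        | nil => rfl
        | cons c R =>
          exfalso
          have : a ∈ c :: R := List.mem_of_mem_getLast? (by simpa using hR)
          exact (List.nodup_cons.1 hnd'.2.1).1 this
      have hRnil' : R' = [] := by
        cases R' with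
        | nil => rfl
        | cons c R' =>
          exfalso
          have hca : c ≠ a := fun h => (List.nodup_cons.1 hbnd).1 (by simp [h])
          have := (hbmem c hca).1 (by simp)
          rw [hRnil] at this
          simp [hca] at this
      simp [hRnil']
    · rw [edges_cons, hbpe] at hedge
      rw [edges_cons, pathEdges_append_of_getLast? (a := x) (by simp), pathEdges_reverse, hEold]
      calc _ = s(x, a) ::ₘ (pathEdges (x :: L₁) + (pathEdges (a :: R') + edges M₁)) := by
            simp only [Multiset.cons_add, Multiset.add_cons, add_assoc]
        _ = _ := by rw [hedge, Multiset.add_cons]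
    · intro v
      have h1 := hend v
      have h2 := hendl v
      rw [ends_cons, hbec] at h1
      rw [ends_cons]
      unfold endCount at h1 ⊢
      rw [hlast', hhead']
      simp only [List.head?_cons, Option.some.injEq, eq_comm (a := v)] at h1 h2 ⊢
      omega
  · refine ⟨(a :: x :: tl) ::ₘ M₀, Multiset.rel_cons_left.2
      ⟨_, _, ⟨List.nodup_cons.2 ⟨ha, hnd⟩, by simp, ?_, ?_⟩, hrefl M₀ fun _ h => h, rfl⟩, ?_, ?_⟩
    · intro v hv
      rw [← hmem v, List.mem_cons]
      simp [hv]
    · intro h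
      simp [endCount]
    · rw [edges_cons, edges_cons, hpe, pathEdges_cons_cons, Multiset.cons_add, Sym2.eq_swap]
    · intro v
      rw [ends_cons, ends_cons, hec]
      unfold endCount
      simp only [List.head?_cons, Option.some.injEq, eq_comm (a := v), List.getLast?_cons_cons]
      omega

end Ends

theorem exists_mem_pathEdges {a : V} (l : List V) (h : a ∈ l) (hne : l ≠ [a]) :
    ∃ e ∈ pathEdges l, a ∈ e := by
  revert h hne
  induction l with
  | nil => simp
  | cons b l ih =>
    cases l with
    | nil => simp +contextual
    | cons c l =>
      intro h _
      rcases List.mem_cons.1 h with rfl | h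
      · exact ⟨s(a, c), by simp, by simp⟩
      · by_cases hcl : c :: l = [a]
        · obtain ⟨rfl, rfl⟩ := List.cons_eq_cons.1 hcl
          exact ⟨s(b, c), by simp, by simp⟩
        · obtain ⟨e, he, hae⟩ := ih h hcl
          exact ⟨e, Multiset.mem_cons_of_mem he, hae⟩

/-! ### Lovász's path decomposition theorem -/

section Lovasz

variable [DecidableEq V]

/-- A family of paths decomposing the edge set `E` in which every vertex has at most two ends, the
number of ends at `v` having the parity of the degree of `v`. -/
structure IsBalanced (E : Finset (Sym2 V)) (M : Multiset (List V)) : Prop where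
  isPath : ∀ l ∈ M, l.Nodup ∧ l ≠ []
  edges_eq : edges M = E.val
  ends_le : ∀ v, ends M v ≤ 2
  even : ∀ v, Even (ends M v + (E.filter (v ∈ ·)).card)

theorem edges_singletons (Z : Finset V) : edges (Z.val.map fun z => [z]) = 0 := by
  induction Z using Finset.induction_on with
  | empty => simp
  | insert z Z hz ih => simp [Finset.insert_val_of_notMem hz, ih]

theorem ends_singletons (Z : Finset V) (v : V) :
    ends (Z.val.map fun z => [z]) v = if v ∈ Z then 2 else 0 := by
  induction Z using Finset.induction_on with
  | empty => simp
  | insert z Z hz ih =>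
    rw [Finset.insert_val_of_notMem hz, Multiset.map_cons, ends_cons, ih]
    by_cases hv : v = z
    · subst hv
      simp [hz, endCount]
    · simp [hv, endCount, Ne.symm hv]

theorem card_filter_erase {E : Finset (Sym2 V)} {e : Sym2 V} (he : e ∈ E) (v : V) :
    (E.filter (v ∈ ·)).card = ((E.erase e).filter (v ∈ ·)).card + (if v ∈ e then 1 else 0) := by
  rw [Finset.filter_erase]
  split_ifs with h
  · rw [Finset.card_erase_add_one (Finset.mem_filter.2 ⟨he, h⟩)]
  · rw [Finset.erase_eq_of_notMem (a := e) (fun h' => h (Finset.mem_filter.1 h').2), add_zero]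

/-- Once trivial paths are placed at the vertices other than `p` without an end, `exists_add_edge`
applies at `p`. A trivial path contributes two ends, so parities and the bound two survive; `p` has
room for the end it gains. -/
theorem IsBalanced.exists_of_erase [Fintype V] {E : Finset (Sym2 V)} {x p : V} (hxp : x ≠ p)
    (he : s(x, p) ∈ E) {M : Multiset (List V)} (hM : IsBalanced (E.erase s(x, p)) M)
    (hp : ends M p ≤ 1) :
    ∃ M', IsBalanced E M' ∧ ends M' p = ends M p + 1 ∧
      ends M' x = if ends M x = 0 then 1 else ends M x - 1 := by
  set Z := Finset.univ.filter fun z => ends M z = 0 ∧ z ≠ p with hZ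
  set N := M + Z.val.map fun z => [z] with hN
  have hNe : edges N = (E.erase s(x, p)).val := by
    rw [hN, edges_add, edges_singletons, hM.edges_eq, add_zero]
  have hNends : ∀ v, ends N v = ends M v + if ends M v = 0 ∧ v ≠ p then 2 else 0 := by
    intro v
    rw [hN, ends_add, ends_singletons]
    simp [hZ]
  obtain ⟨M', hrel, hedge, hends⟩ := exists_add_edge (x := x) (a := p) N
    (by
      intro l hl
      rcases Multiset.mem_add.1 hl with hl | hl
      · exact hM.isPath l hl
      · obtain ⟨z, -, rfl⟩ := Multiset.mem_map.1 hl
        simp)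
    (by rw [hNe]; exact Finset.nodup _) hxp (by rw [hNe]; exact Finset.notMem_erase _ _)
    (by
      intro z hz
      have hzp : z ≠ p := by
        rcases hz with rfl | hz
        · exact hxp
        · rintro rfl
          obtain ⟨l, hl, hlz⟩ := mem_edges.1 hz
          have hl' : l.Nodup := by
            rcases Multiset.mem_add.1 hl with hl | hl
            · exact (hM.isPath l hl).1
            · obtain ⟨y, -, rfl⟩ := Multiset.mem_map.1 hl
              simp
          clear hl
          induction l with
          | nil => simp at hlz
          | cons b l ih =>
            cases l with
            | nil => simp at hlz
            | cons c l =>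
              rw [pathEdges_cons_cons, Multiset.mem_cons] at hlz
              rcases hlz with h | h
              · rcases Sym2.eq_iff.1 h with ⟨rfl, rfl⟩ | ⟨rfl, rfl⟩ <;> simp at hl'
              · exact ih h (List.nodup_cons.1 hl').2
      rw [hNends]
      split_ifs with h
      · omega
      · have : ends M z ≠ 0 := fun h0 => h ⟨h0, hzp⟩
        omega)
  have hpath : ∀ l ∈ M', l.Nodup ∧ l ≠ [] := by
    intro l hl
    obtain ⟨l', -, h⟩ := Multiset.exists_mem_of_rel_of_mem (Multiset.rel_flip.2 hrel) hl
    exact ⟨h.1, h.2.1⟩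
  refine ⟨M', ⟨hpath, ?_, ?_, ?_⟩, ?_, ?_⟩
  · rw [hedge, hNe, ← Finset.insert_val_of_notMem (by simp), Finset.insert_erase he]
  · intro v
    have h1 := hends v
    have h2 := hNends v
    have h3 := hM.ends_le v
    by_cases hv : v = p
    · subst hv
      rw [if_neg hxp.symm, if_pos rfl] at h1
      rw [if_neg (by simp)] at h2
      omega
    · rw [if_neg hv] at h1
      split_ifs at h2 <;> omega
  · intro v
    have h1 := hends v
    have h2 := hNends v
    have h3 := hM.even v
    rw [card_filter_erase he v]
    have h4 : (if v ∈ s(x, p) then 1 else 0) =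
        (if v = x then 1 else 0) + (if v = p then 1 else 0) := by
      by_cases hvx : v = x
      · subst hvx; simp [hxp]
      · simp [hvx]
    rw [h4]
    rw [Nat.even_iff] at h3 ⊢
    split_ifs at * <;> omega
  · have h1 := hends p
    have h2 := hNends p
    rw [if_neg hxp.symm, if_pos rfl] at h1
    rw [if_neg (by simp)] at h2
    omega
  · have h1 := hends x
    have h2 := hNends x
    rw [if_neg hxp, if_pos rfl] at h1
    simp only [ne_eq, hxp, not_false_eq_true, and_true] at h2
    split_ifs at * <;> omega

/-- Only trivial paths can meet an isolated vertex; discard them. -/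
theorem ends_eq_zero_of_isolated {E : Finset (Sym2 V)} {M : Multiset (List V)}
    (hM : IsBalanced E M) {a : V} (ha : ∀ e ∈ E, a ∉ e) :
    ∃ M', IsBalanced E M' ∧ ends M' a = 0 := by
  have key : ∀ l ∈ M, a ∈ l → l = [a] := by
    intro l hl hal
    by_contra hne
    obtain ⟨e, he, hae⟩ := exists_mem_pathEdges l hal hne
    have : e ∈ edges M := mem_edges.2 ⟨l, hl, he⟩
    rw [hM.edges_eq] at this
    exact ha e this hae
  have hsplit := Multiset.filter_add_not (· = [a]) M
  obtain ⟨k, hk⟩ : ∃ k, M.filter (· = [a]) = Multiset.replicate k [a] :=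
    ⟨_, Multiset.eq_replicate_card.2 fun l hl => (Multiset.mem_filter.1 hl).2⟩
  have he : ∀ k, edges (Multiset.replicate k [a]) = 0 := by
    intro k
    induction k with
    | zero => rfl
    | succ k ih => simp [Multiset.replicate_succ, ih]
  have hends : ∀ k v, ends (Multiset.replicate k [a]) v = if v = a then 2 * k else 0 := by
    intro k v
    induction k with
    | zero => simp
    | succ k ih =>
      simp only [Multiset.replicate_succ, ends_cons, ih, endCount]
      by_cases hv : v = a
      · subst hv; simp; omega
      · simp [hv, Ne.symm hv]
  rw [hk] at hsplit
  set M' := M.filter fun l => ¬ l = [a] with hM'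
  have hE : ∀ v, ends M v = (if v = a then 2 * k else 0) + ends M' v := by
    intro v
    rw [← hends, ← ends_add, hsplit]
  refine ⟨M', ⟨fun l hl => hM.isPath l (Multiset.mem_filter.1 hl).1, ?_, ?_, ?_⟩, ?_⟩
  · rw [← hM.edges_eq, ← hsplit, edges_add, he, zero_add]
  · intro v
    have := hM.ends_le v
    rw [hE] at this
    omega
  · intro v
    have := hM.even v
    rw [hE] at this
    rw [Nat.even_iff] at this ⊢
    split_ifs at this <;> omega
  · by_contra h
    obtain ⟨l, hl, h1⟩ := exists_of_ends_pos (Nat.pos_of_ne_zero h)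
    have hl' := Multiset.mem_filter.1 hl
    exact hl'.2 (key l hl'.1 (mem_of_endCount_pos h1))

/-- Lovász's theorem, with a prescribed vertex having at most one end. -/
theorem exists_isBalanced [Fintype V] (E : Finset (Sym2 V)) (hE : ∀ e ∈ E, ¬ e.IsDiag) (a : V) :
    ∃ M, IsBalanced E M ∧ ends M a ≤ 1 := by
  induction hn : E.card generalizing E a with
  | zero =>
    rw [Finset.card_eq_zero] at hn
    subst hn
    exact ⟨0, ⟨by simp, by simp, by simp, by simp⟩, by simp⟩
  | succ n ih =>
  have key : ∀ b x, s(b, x) ∈ E → ∃ M, IsBalanced E M ∧ ends M b ≤ 1 := by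
    intro b x hbx
    have hne : b ≠ x := fun h => hE _ hbx (by simp [h])
    have hE' : ∀ e ∈ E.erase s(b, x), ¬ e.IsDiag := fun e he => hE e (Finset.mem_of_mem_erase he)
    have hcard : (E.erase s(b, x)).card = n := by rw [Finset.card_erase_of_mem hbx, hn]; rfl
    have hdeg := card_filter_erase hbx b
    rw [if_pos (by simp)] at hdeg
    -- Even degree: insert `bx` so that the end moves from `b` to `x`, which leaves at most one at
    -- `b`. Odd degree: move it from `x` to `b`; parity then excludes two ends at `b`.
    rcases Nat.even_or_odd (E.filter (b ∈ ·)).card with hpar | hpar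
    · obtain ⟨M, hM, hMx⟩ := ih _ hE' x hcard
      obtain ⟨M', hM', -, h⟩ := hM.exists_of_erase hne hbx hMx
      refine ⟨M', hM', ?_⟩
      have := hM.ends_le b
      split_ifs at h <;> omega
    · obtain ⟨M, hM, hMb⟩ := ih _ hE' b hcard
      rw [Sym2.eq_swap] at hM hbx hdeg
      obtain ⟨M', hM', h, -⟩ := hM.exists_of_erase hne.symm hbx hMb
      refine ⟨M', hM', ?_⟩
      have h2 := hM.even b
      rw [Nat.even_iff] at h2
      rw [Nat.odd_iff] at hpar
      omega
  by_cases ha : ∃ x, s(a, x) ∈ E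
  · obtain ⟨x, hx⟩ := ha
    exact key a x hx
  · obtain ⟨e, he⟩ := Finset.card_pos.1 (by omega : 0 < E.card)
    induction e with
    | _ b x =>
    obtain ⟨M, hM, -⟩ := key b x he
    obtain ⟨M', hM', h⟩ := ends_eq_zero_of_isolated hM (a := a) (by
      intro e he hae
      obtain ⟨y, rfl⟩ := hae
      exact ha ⟨y, he⟩)
    exact ⟨M', hM', by omega⟩

end Lovasz

/-! ### Orienting multigraphs of maximum degree two -/

section Orientation

/-- The number of coordinates of the pair `p` equal to `v`. -/
def pairCount [DecidableEq V] (v : V) (p : V × V) : ℕ :=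
  (if p.1 = v then 1 else 0) + (if p.2 = v then 1 else 0)

theorem sum_pairCount_of_rel [DecidableEq V] {N N' : Multiset (V × V)}
    (h : Multiset.Rel (fun p q => q = p ∨ q = p.swap) N N') (v : V) :
    (N'.map (pairCount v)).sum = (N.map (pairCount v)).sum := by
  induction h with
  | zero => rfl
  | cons hpq _ ih =>
    rw [Multiset.map_cons, Multiset.map_cons, Multiset.sum_cons, Multiset.sum_cons, ih]
    rcases hpq with rfl | rfl <;> simp [pairCount, add_comm]

theorem sum_pairCount_pos [DecidableEq V] {N : Multiset (V × V)} {v : V} {p : V × V}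
    (hp : p ∈ N) (h : p.1 = v ∨ p.2 = v) : 0 < (N.map (pairCount v)).sum := by
  obtain ⟨N', rfl⟩ := Multiset.exists_cons_of_mem hp
  rw [Multiset.map_cons, Multiset.sum_cons]
  rcases h with h | h <;> simp [pairCount, h]

theorem exists_cons_cons_of_not_nodup_map {α β : Type*} {f : α → β} {N : Multiset α}
    (h : ¬ (N.map f).Nodup) : ∃ p q N₀, N = p ::ₘ q ::ₘ N₀ ∧ f p = f q := by
  induction N using Multiset.induction_on with
  | empty => simp at h
  | cons p N ih =>
    rw [Multiset.map_cons, Multiset.nodup_cons, not_and_or, not_not] at h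
    rcases h with h | h
    · obtain ⟨q, hq, hqp⟩ := Multiset.mem_map.1 h
      obtain ⟨N₀, rfl⟩ := Multiset.exists_cons_of_mem hq
      exact ⟨p, q, N₀, rfl, hqp.symm⟩
    · obtain ⟨r, q, N₀, rfl, hrq⟩ := ih h
      refine ⟨r, q, p ::ₘ N₀, ?_, hrq⟩
      rw [Multiset.cons_swap p r, Multiset.cons_swap p q]

/-- A multigraph of maximum degree two can be oriented with in- and outdegrees at most one. -/
theorem exists_orientation [DecidableEq V] (N : Multiset (V × V))
    (hN : ∀ v, (N.map (pairCount v)).sum ≤ 2) :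
    ∃ N', Multiset.Rel (fun p q => q = p ∨ q = p.swap) N N' ∧
      (N'.map Prod.fst).Nodup ∧ (N'.map Prod.snd).Nodup := by
  induction hn : N.card using Nat.strong_induction_on generalizing N with
  | _ n ih =>
  have main : ∀ (N₁ : Multiset (V × V)), Multiset.Rel (fun p q => q = p ∨ q = p.swap) N N₁ →
      ∀ v p q N₀, N₁ = (v, p) ::ₘ (v, q) ::ₘ N₀ →
      ∃ N', Multiset.Rel (fun p q => q = p ∨ q = p.swap) N N' ∧
      (N'.map Prod.fst).Nodup ∧ (N'.map Prod.snd).Nodup := by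
    rintro N₁ hrel v p q N₀ rfl
    have hsum := fun u => sum_pairCount_of_rel hrel u
    have hv := (hsum v).trans_le (hN v)
    simp only [Multiset.map_cons, Multiset.sum_cons, pairCount, if_true] at hv
    have hpv : p ≠ v := fun h => by simp [h] at hv
    have hqv : q ≠ v := fun h => by simp [h] at hv; omega
    -- Suppress `v`: replace its two edges by one edge `pq`, orient the smaller multigraph, then
    -- subdivide `pq` again in the direction it received. As `v` is saturated, it occurs in no other
    -- pair.
    obtain ⟨N', hN', h1, h2⟩ := ih (N₀.card + 1) (by
        rw [← hn, Multiset.card_eq_card_of_rel hrel]; simp) ((p, q) ::ₘ N₀) (by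
          intro u
          have := (hsum u).trans_le (hN u)
          simp only [Multiset.map_cons, Multiset.sum_cons, pairCount] at this ⊢
          omega) (by simp)
    obtain ⟨b, N₂, hb, hN₂, rfl⟩ := Multiset.rel_cons_left.1 hN'
    have hz : (N₂.map (pairCount v)).sum = 0 := by
      rw [sum_pairCount_of_rel hN₂]
      change _ + (_ + (N₀.map (pairCount v)).sum) ≤ 2 at hv
      omega
    have hv1 : v ∉ N₂.map Prod.fst := fun h => by
      obtain ⟨r, hr, hrv⟩ := Multiset.mem_map.1 h
      have := sum_pairCount_pos hr (Or.inl hrv)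
      omega
    have hv2 : v ∉ N₂.map Prod.snd := fun h => by
      obtain ⟨r, hr, hrv⟩ := Multiset.mem_map.1 h
      have := sum_pairCount_pos hr (Or.inr hrv)
      omega
    have htrans : ∀ N', Multiset.Rel (fun p q => q = p ∨ q = p.swap)
        ((v, p) ::ₘ (v, q) ::ₘ N₀) N' →
        Multiset.Rel (fun p q => q = p ∨ q = p.swap) N N' := by
      intro N' h
      have : IsTrans (V × V) (fun p q => q = p ∨ q = p.swap) := ⟨by
        rintro a b c (rfl | rfl) (rfl | rfl) <;> simp⟩
      exact Multiset.Rel.trans _ hrel h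
    rw [Multiset.map_cons, Multiset.nodup_cons] at h1 h2
    rcases hb with rfl | rfl
    · refine ⟨(p, v) ::ₘ (v, q) ::ₘ N₂, htrans _ ?_, ?_, ?_⟩
      · exact Multiset.Rel.cons (Or.inr rfl) (Multiset.Rel.cons (Or.inl rfl) hN₂)
      · simp only [Multiset.map_cons, Multiset.nodup_cons, Multiset.mem_cons, not_or]
        exact ⟨⟨hpv, h1.1⟩, hv1, h1.2⟩
      · simp only [Multiset.map_cons, Multiset.nodup_cons, Multiset.mem_cons, not_or]
        exact ⟨⟨hqv.symm, hv2⟩, h2.1, h2.2⟩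
    · refine ⟨(v, p) ::ₘ (q, v) ::ₘ N₂, htrans _ ?_, ?_, ?_⟩
      · exact Multiset.Rel.cons (Or.inl rfl) (Multiset.Rel.cons (Or.inr rfl) hN₂)
      · simp only [Multiset.map_cons, Multiset.nodup_cons, Multiset.mem_cons, not_or]
        exact ⟨⟨hqv.symm, hv1⟩, h1.1, h1.2⟩
      · simp only [Multiset.map_cons, Multiset.nodup_cons, Multiset.mem_cons, not_or]
        exact ⟨⟨hpv, h2.1⟩, hv2, h2.2⟩
  have hrefl : Multiset.Rel (fun p q : V × V => q = p ∨ q = p.swap) N N :=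
    Multiset.rel_refl_of_refl_on fun _ _ => Or.inl rfl
  by_cases h1 : (N.map Prod.fst).Nodup
  · by_cases h2 : (N.map Prod.snd).Nodup
    · exact ⟨N, hrefl, h1, h2⟩
    · obtain ⟨⟨p, v⟩, ⟨q, v'⟩, N₀, rfl, h : v = v'⟩ := exists_cons_cons_of_not_nodup_map h2
      subst h
      refine main ((v, p) ::ₘ (v, q) ::ₘ N₀.map Prod.swap) ?_ v p q _ rfl
      refine Multiset.Rel.cons (Or.inr rfl) (Multiset.Rel.cons (Or.inr rfl) ?_)
      exact Multiset.rel_map_right.2 (Multiset.rel_refl_of_refl_on fun _ _ => Or.inr rfl)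
  · obtain ⟨⟨v, p⟩, ⟨v', q⟩, N₀, rfl, h : v = v'⟩ := exists_cons_cons_of_not_nodup_map h1
    subst h
    exact main _ hrefl v p q N₀ rfl

end Orientation

/-! ### One path starting at each vertex -/

theorem edges_of_rel_reverse {M M' : Multiset (List V)}
    (h : Multiset.Rel (fun l l' => l' = l ∨ l' = l.reverse) M M') : edges M' = edges M := by
  induction h with
  | zero => rfl
  | cons hl _ ih => rcases hl with rfl | rfl <;> simp [ih]

theorem exists_lift_orientation {M : Multiset (List V)} {N : Multiset (Option V × Option V)}
    (h : Multiset.Rel (fun l q => q = (l.head?, l.getLast?) ∨ q = (l.getLast?, l.head?)) M N) :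
    ∃ M', Multiset.Rel (fun l l' => l' = l ∨ l' = l.reverse) M M' ∧
      M'.map (fun l => (l.head?, l.getLast?)) = N := by
  induction h with
  | zero => exact ⟨0, Multiset.Rel.zero, rfl⟩
  | @cons l q M N hl _ ih =>
    obtain ⟨M', h1, rfl⟩ := ih
    rcases hl with rfl | rfl
    · exact ⟨l ::ₘ M', Multiset.Rel.cons (Or.inl rfl) h1, by simp⟩
    · exact ⟨l.reverse ::ₘ M', Multiset.Rel.cons (Or.inr rfl) h1, by simp⟩

/-- Every graph decomposes into paths, one starting at each vertex (possibly a trivial one), such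
that at most two of them finish at any given vertex. -/
theorem exists_rooted_paths [Fintype V] [DecidableEq V] (E : Finset (Sym2 V))
    (hE : ∀ e ∈ E, ¬ e.IsDiag) :
    ∃ Q : V → List V, (∀ w, (Q w).Nodup ∧ (Q w).head? = some w) ∧
      edges (Finset.univ.val.map Q) = E.val ∧
      ∀ v, (Finset.univ.filter fun w => (Q w).getLast? = some v).card ≤ 2 := by
  classical
  rcases isEmpty_or_nonempty V with hV | ⟨⟨a⟩⟩
  · refine ⟨fun _ => [], fun w => hV.elim w, ?_, fun v => hV.elim v⟩
    rw [Finset.univ_eq_empty, Finset.eq_empty_of_forall_notMem (s := E)]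
    · simp
    · intro e
      induction e with
      | _ x y => exact hV.elim x
  obtain ⟨M, hM, -⟩ := exists_isBalanced E hE a
  -- The ends lie in `Option V`; `none` never occurs, the paths being nonempty.
  obtain ⟨N, hN, hfst, hsnd⟩ := exists_orientation (M.map fun l => (l.head?, l.getLast?)) (by
    intro o
    rw [Multiset.map_map]
    cases o with
    | none =>
      rw [Multiset.map_congr rfl (g := fun _ => 0)]
      · simp
      · intro l hl
        simp [pairCount, (hM.isPath l hl).2]
    | some v => exact hM.ends_le v)
  rw [Multiset.rel_map_left] at hN
  obtain ⟨M', hrel, rfl⟩ := exists_lift_orientation hN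
  rw [Multiset.map_map] at hfst hsnd
  have hpath : ∀ l ∈ M', l.Nodup := by
    intro l hl
    obtain ⟨l', hl', h⟩ := Multiset.exists_mem_of_rel_of_mem (Multiset.rel_flip.2 hrel) hl
    rcases h with rfl | rfl
    · exact (hM.isPath _ hl').1
    · exact List.nodup_reverse.2 (hM.isPath _ hl').1
  have hne : ∀ l ∈ M', l ≠ [] := by
    intro l hl
    obtain ⟨l', hl', h⟩ := Multiset.exists_mem_of_rel_of_mem (Multiset.rel_flip.2 hrel) hl
    rcases h with rfl | rfl
    · exact (hM.isPath _ hl').2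
    · simpa using (hM.isPath _ hl').2
  set S : Finset V := Finset.univ.filter fun w => ∃ l ∈ M', l.head? = some w with hS
  have hSmem : ∀ w, w ∈ S ↔ ∃ l ∈ M', l.head? = some w := by simp [hS]
  have hQ : ∀ w, ∃ l : List V, l.Nodup ∧ l.head? = some w ∧ (w ∈ S → l ∈ M') ∧
      (w ∉ S → l = [w]) := by
    intro w
    by_cases hw : w ∈ S
    · obtain ⟨l, hl, hlw⟩ := (hSmem w).1 hw
      exact ⟨l, hpath l hl, hlw, fun _ => hl, fun h => absurd hw h⟩
    · exact ⟨[w], by simp, by simp, fun h => absurd h hw, fun _ => rfl⟩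
  choose Q hQnd hQhead hQin hQout using hQ
  have hSQ : S.val.map Q = M' := by
    refine (Multiset.Nodup.ext ?_ (Multiset.Nodup.of_map _ hfst)).2 ?_
    · refine Multiset.Nodup.map_on ?_ S.nodup
      intro x _ y _ hxy
      have := hQhead x
      rw [hxy, hQhead y] at this
      exact (Option.some.inj this).symm
    · intro l
      rw [Multiset.mem_map]
      constructor
      · rintro ⟨w, hw, rfl⟩
        exact hQin w hw
      · intro hl
        obtain ⟨w, hw⟩ : ∃ w, l.head? = some w := by
          rw [← Option.isSome_iff_exists]
          simpa using hne l hl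
        have hwS : w ∈ S := (hSmem w).2 ⟨l, hl, hw⟩
        refine ⟨w, hwS, ?_⟩
        exact Multiset.inj_on_of_nodup_map hfst _ (hQin w hwS) _ hl ((hQhead w).trans hw.symm)
  refine ⟨Q, fun w => ⟨hQnd w, hQhead w⟩, ?_, ?_⟩
  · have hsplit : Finset.univ.val.map Q = M' + Sᶜ.val.map fun z => [z] := by
      rw [← hSQ, ← Finset.union_compl S, ← Finset.disjUnion_eq_union _ _ disjoint_compl_right,
        Finset.disjUnion_val, Multiset.map_add]
      congr 1
      exact Multiset.map_congr rfl fun w hw => hQout w (Finset.mem_compl.1 hw)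
    rw [hsplit, edges_add, edges_singletons, add_zero, edges_of_rel_reverse hrel, hM.edges_eq]
  · intro v
    -- A path finishing at `v` is either the trivial one at `v` or one of the oriented paths, of
    -- which at most one finishes there.
    have hsub : (Finset.univ.filter fun w => (Q w).getLast? = some v) ⊆
        insert v (S.filter fun w => (Q w).getLast? = some v) := by
      intro w hw
      rw [Finset.mem_filter] at hw
      by_cases hwS : w ∈ S
      · exact Finset.mem_insert_of_mem (Finset.mem_filter.2 ⟨hwS, hw.2⟩)
      · rw [hQout w hwS] at hw
        simp at hw
        simp [hw]
    refine (Finset.card_le_card hsub).trans ((Finset.card_insert_le _ _).trans ?_)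
    refine Nat.succ_le_succ (Finset.card_le_one.2 ?_)
    intro x hx y hy
    rw [Finset.mem_filter] at hx hy
    have h := Multiset.inj_on_of_nodup_map hsnd _ (hQin x hx.1) _ (hQin y hy.1)
      (hx.2.trans hy.2.symm)
    have h2 := hQhead x
    rw [h, hQhead y] at h2
    exact (Option.some.inj h2).symm

/-! ### Strands along a path of the tree -/

theorem edges_map (s : Finset W) (f : W → List X) :
    edges (s.val.map f) = ∑ w ∈ s, pathEdges (f w) := by
  rw [edges, Multiset.map_map]; rfl

theorem map_edges (f : V → X) (M : Multiset (List V)) :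
    (edges M).map (Sym2.map f) = edges (M.map (List.map f)) := by
  induction M using Multiset.induction_on with
  | empty => rfl
  | cons l M ih => simp [ih, pathEdges_map]

/-- Given paths finishing at `base (f w)` where `f` has fibres of size at most two, choose one of
them finishing at each `base v` (or a trivial one), leaving at most half of the paths over. -/
theorem exists_recycle [Fintype W] (ext : W → List X) (f : W → W) (base : W → X)
    (hlast : ∀ w, (ext w).getLast? = some (base (f w)))
    (hfib : ∀ v, {w | f w = v}.ncard ≤ 2) :
    ∃ (act : W → List X) (rest : Multiset (List X)),
      (∀ w, (act w).getLast? = some (base w)) ∧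
      (∀ w, (∃ w', act w = ext w') ∨ act w = [base w]) ∧
      (∀ l ∈ rest, ∃ w, l = ext w) ∧
      (∑ w, pathEdges (act w)) + edges rest = ∑ w, pathEdges (ext w) ∧
      2 * rest.card ≤ Fintype.card W := by
  classical
  set I := Finset.univ.image f with hI
  have hg : ∀ v, ∃ w, v ∈ I → f w = v := by
    intro v
    by_cases hv : v ∈ I
    · obtain ⟨w, -, hw⟩ := Finset.mem_image.1 hv
      exact ⟨w, fun _ => hw⟩
    · exact ⟨v, fun h => absurd h hv⟩
  choose g hg using hg
  have hinj : Set.InjOn g I := fun x hx y hy hxy => by rw [← hg x hx, hxy, hg y hy]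
  have hcard : Fintype.card W ≤ 2 * I.card := by
    refine Finset.card_le_mul_card_image (f := f) Finset.univ 2 fun v _ => ?_
    refine le_trans (le_of_eq ?_) (hfib v)
    rw [← Set.ncard_coe_finset]
    simp
  refine ⟨fun v => if v ∈ I then ext (g v) else [base v], (I.image g)ᶜ.val.map ext,
    ?_, ?_, ?_, ?_, ?_⟩
  · intro v
    dsimp only
    split_ifs with hv
    · rw [hlast, hg v hv]
    · rfl
  · intro v
    dsimp only
    split_ifs with hv
    · exact Or.inl ⟨_, rfl⟩
    · exact Or.inr rfl
  · intro l hl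
    obtain ⟨w, -, rfl⟩ := Multiset.mem_map.1 hl
    exact ⟨w, rfl⟩
  · rw [edges_map, ← Finset.sum_add_sum_compl (I.image g) fun w => pathEdges (ext w),
      Finset.sum_image hinj, ← Finset.sum_add_sum_compl I,
      Finset.sum_eq_zero (s := Iᶜ), add_zero]
    · congr 1
      exact Finset.sum_congr rfl fun v hv => by simp only [hv, if_true]
    · intro v hv
      simp only [Finset.mem_compl.1 hv, if_false, pathEdges_singleton]
  · rw [Multiset.card_map, Finset.card_val, Finset.card_compl, Finset.card_image_of_injOn hinj]
    omega

/-- The copy over `t` of a multiset of edges. -/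
def fibreCopy (E : Multiset (Sym2 W)) (t : V) : Multiset (Sym2 (V × W)) :=
  E.map (Sym2.map (Prod.mk t))

section Strands

variable [Fintype W] [DecidableEq V] {Q : W → List W}

/-- Induction along the `T`-path: `act w` is the strand that has reached `(t, w)`, and freshness of
the later copies keeps strands simple. Each copy over `S` makes at most half of the strands stop,
except the last, where nothing needs recycling; hence `dropLast`. -/
theorem exists_extend_strands (hQ : ∀ w, (Q w).Nodup ∧ (Q w).head? = some w)
    (hfib : ∀ v, {w | (Q w).getLast? = some v}.ncard ≤ 2) (S : Finset V) (l : List V) (t : V)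
    (htl : (t :: l).Nodup) (act : W → List (V × W))
    (hact : ∀ w, (act w).Nodup ∧ (act w).getLast? = some (t, w))
    (hfresh : ∀ w, ∀ q ∈ act w, q.1 ∉ l) :
    ∃ M : Multiset (List (V × W)), (∀ p ∈ M, p.Nodup) ∧
      edges M = (∑ w, pathEdges (act w)) + (∑ w, pathEdges ((t :: l).map fun u => (u, w))) +
        ((l.filter (· ∈ S)).map (fibreCopy (edges (Finset.univ.val.map Q)))).sum ∧
      2 * M.card ≤ 2 * Fintype.card W +
        Fintype.card W * (l.dropLast.filter (· ∈ S)).length := by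
  induction l generalizing t act with
  | nil =>
    refine ⟨Finset.univ.val.map act, ?_, ?_, ?_⟩
    · intro p hp
      obtain ⟨w, -, rfl⟩ := Multiset.mem_map.1 hp
      exact (hact w).1
    · simp [edges_map]
    · simp
  | cons t' l ih =>
  -- Outside `S` the strands pass straight through, which is the same step with trivial rooted
  -- paths.
  set Q' : W → List W := fun w => if t' ∈ S then Q w else [w] with hQ'
  have hQ'nd : ∀ w, (Q' w).Nodup ∧ (Q' w).head? = some w := by
    intro w
    by_cases h : t' ∈ S
    · simpa [hQ', h] using hQ w
    · simp [hQ', h]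
  have hf : ∀ w, ∃ v, (Q' w).getLast? = some v := by
    intro w
    rw [← Option.isSome_iff_exists]
    have := (hQ'nd w).2
    cases h : Q' w with
    | nil => simp [h] at this
    | cons a r => simp
  choose f hf using hf
  have hffib : ∀ v, {w | f w = v}.ncard ≤ 2 := by
    intro v
    by_cases h : t' ∈ S
    · convert hfib v using 4 with w
      have := hf w
      simp only [hQ', h, if_true] at this
      rw [this, Option.some.injEq]
    · have : {w | f w = v} = {v} := by
        ext w
        have := hf w
        simp only [hQ', h, if_false, List.getLast?_singleton, Option.some.injEq] at this
        simp [← this]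
      rw [this, Set.ncard_singleton]
      omega
  set ext : W → List (V × W) := fun w => act w ++ (Q' w).map (Prod.mk t') with hext
  have hextnd : ∀ w, (ext w).Nodup := by
    intro w
    rw [hext, List.nodup_append']
    refine ⟨(hact w).1, (hQ'nd w).1.map (Prod.mk_right_injective t'), fun q h1 h2 => ?_⟩
    obtain ⟨v, -, rfl⟩ := List.mem_map.1 h2
    exact hfresh w _ h1 (by simp)
  have hextlast : ∀ w, (ext w).getLast? = some (t', f w) := by
    intro w
    have hne : Q' w ≠ [] := fun h => by simpa [h] using (hQ'nd w).2
    rw [hext]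
    dsimp only
    rw [List.getLast?_append_of_ne_nil _ (by simpa using hne), List.getLast?_map, hf w]
    rfl
  have hextmem : ∀ w, ∀ q ∈ ext w, q.1 ∉ l := by
    intro w q hq
    rcases List.mem_append.1 hq with hq | hq
    · exact fun h => hfresh w q hq (List.mem_cons_of_mem _ h)
    · obtain ⟨v, -, rfl⟩ := List.mem_map.1 hq
      exact (List.nodup_cons.1 (List.nodup_cons.1 htl).2).1
  have hextedge : ∀ w, pathEdges (ext w) =
      pathEdges (act w) + s((t, w), (t', w)) ::ₘ pathEdges ((Q' w).map (Prod.mk t')) := by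
    intro w
    obtain ⟨r, hr⟩ := List.head?_eq_some_iff.1 (hQ'nd w).2
    rw [hext]
    dsimp only
    rw [hr, List.map_cons, pathEdges_append_of_getLast? (hact w).2]
  have hcopy : (∑ w, pathEdges ((Q' w).map (Prod.mk t'))) =
      if t' ∈ S then fibreCopy (edges (Finset.univ.val.map Q)) t' else 0 := by
    split_ifs with h
    · rw [fibreCopy, map_edges, Multiset.map_map, edges_map]
      simp [hQ', h]
    · simp [hQ', h]
  have hextsum : (∑ w, pathEdges (ext w)) = (∑ w, pathEdges (act w)) +
      (∑ w, ({s((t, w), (t', w))} : Multiset (Sym2 (V × W)))) +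
      if t' ∈ S then fibreCopy (edges (Finset.univ.val.map Q)) t' else 0 := by
    rw [← hcopy, ← Finset.sum_add_distrib, ← Finset.sum_add_distrib]
    refine Finset.sum_congr rfl fun w _ => ?_
    rw [hextedge, ← Multiset.singleton_add, add_assoc]
  have hrail : (∑ w, pathEdges ((t :: t' :: l).map fun u => (u, w))) =
      (∑ w, ({s((t, w), (t', w))} : Multiset (Sym2 (V × W)))) + ∑ w, pathEdges ((t' :: l).map fun u => (u, w)) := by
    rw [← Finset.sum_add_distrib]
    refine Finset.sum_congr rfl fun w _ => ?_
    rw [List.map_cons, List.map_cons, pathEdges_cons_cons, Multiset.singleton_add]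
  have hfilter : (((t' :: l).filter (· ∈ S)).map
      (fibreCopy (edges (Finset.univ.val.map Q)))).sum =
      (if t' ∈ S then fibreCopy (edges (Finset.univ.val.map Q)) t' else 0) +
      ((l.filter (· ∈ S)).map (fibreCopy (edges (Finset.univ.val.map Q)))).sum := by
    by_cases h : t' ∈ S <;> simp [h]
  rcases List.eq_nil_or_concat l with hl | hl
  · subst hl
    refine ⟨Finset.univ.val.map ext, ?_, ?_, ?_⟩
    · intro p hp
      obtain ⟨w, -, rfl⟩ := Multiset.mem_map.1 hp
      exact hextnd w
    · rw [edges_map, hextsum, hrail, hfilter]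
      simp
    · simp
  have hlne : l ≠ [] := by
    obtain ⟨l', a, rfl⟩ := hl
    simp
  rw [hrail, hfilter, List.dropLast_cons_of_ne_nil hlne]
  by_cases h : t' ∈ S
  · obtain ⟨act', rest, hlast', hmem', hrest, hsum', hcard'⟩ :=
      exists_recycle ext f (Prod.mk t') hextlast hffib
    obtain ⟨M, hM1, hM2, hM3⟩ := ih t' (List.nodup_cons.1 htl).2 act'
      (by
        intro w
        refine ⟨?_, hlast' w⟩
        rcases hmem' w with ⟨w', hw⟩ | hw <;> rw [hw]
        · exact hextnd w'
        · simp)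
      (by
        intro w q hq
        rcases hmem' w with ⟨w', hw⟩ | hw <;> rw [hw] at hq
        · exact hextmem w' q hq
        · rw [List.mem_singleton.1 hq]
          exact (List.nodup_cons.1 (List.nodup_cons.1 htl).2).1)
    refine ⟨M + rest, ?_, ?_, ?_⟩
    · intro p hp
      rcases Multiset.mem_add.1 hp with hp | hp
      · exact hM1 p hp
      · obtain ⟨w, rfl⟩ := hrest p hp
        exact hextnd w
    · rw [edges_add, hM2]
      rw [hextsum] at hsum'
      calc _ = ((∑ w, pathEdges (act' w)) + edges rest) +
            ((∑ w, pathEdges ((t' :: l).map fun u => (u, w))) +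
            ((l.filter (· ∈ S)).map (fibreCopy (edges (Finset.univ.val.map Q)))).sum) := by abel
        _ = _ := by rw [hsum']; abel
    · rw [Multiset.card_add, List.filter_cons_of_pos (by simpa using h), List.length_cons]
      linarith
  · have hfid : ∀ w, f w = w := by
      intro w
      have := hf w
      simp only [hQ', h, if_false, List.getLast?_singleton, Option.some.injEq] at this
      exact this.symm
    obtain ⟨M, hM1, hM2, hM3⟩ := ih t' (List.nodup_cons.1 htl).2 ext
      (fun w => ⟨hextnd w, by rw [hextlast, hfid]⟩) hextmem
    refine ⟨M, hM1, ?_, ?_⟩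
    · rw [hM2, hextsum]
      abel
    · rw [List.filter_cons_of_neg (by simpa using h)]
      exact hM3

/-- The strands start as reversed `Q w` in the first copy, so one arrives at each `(t, w)`. Both
ends of `R` lie in `S`, so only `|S| - 2` copies cost `n/2` on top of the initial `n`. -/
theorem exists_strands (hQ : ∀ w, (Q w).Nodup ∧ (Q w).head? = some w)
    (hfib : ∀ v, {w | (Q w).getLast? = some v}.ncard ≤ 2) (R : List V) (hR : R.Nodup)
    (hlen : 2 ≤ R.length) (S : Finset V) (hS : ∀ t ∈ S, t ∈ R)
    (hends : ∀ t, 0 < endCount t R → t ∈ S) :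
    ∃ M : Multiset (List (V × W)), (∀ p ∈ M, p.Nodup) ∧
      edges M = (∑ w, pathEdges (R.map fun u => (u, w))) +
        ∑ t ∈ S, fibreCopy (edges (Finset.univ.val.map Q)) t ∧
      2 * M.card ≤ Fintype.card W * S.card := by
  obtain ⟨t, l, rfl⟩ : ∃ t l, R = t :: l := by
    cases R with
    | nil => simp at hlen
    | cons t l => exact ⟨t, l, rfl⟩
  have hl : l ≠ [] := by rintro rfl; simp at hlen
  obtain ⟨l', u, rfl⟩ : ∃ l' u, l = l' ++ [u] := ⟨_, _, (List.dropLast_append_getLast hl).symm⟩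
  have ht : t ∈ S := hends t (by simp [endCount])
  have hu : u ∈ S := hends u (by
    rw [endCount, ← List.cons_append, List.getLast?_concat]
    simp)
  obtain ⟨M, hM1, hM2, hM3⟩ := exists_extend_strands hQ hfib S (l' ++ [u]) t hR
    (fun w => ((Q w).reverse).map (Prod.mk t))
    (by
      intro w
      refine ⟨(List.nodup_reverse.2 (hQ w).1).map (Prod.mk_right_injective t), ?_⟩
      rw [List.getLast?_map, List.getLast?_reverse, (hQ w).2]
      rfl)
    (by
      intro w q hq
      obtain ⟨v, -, rfl⟩ := List.mem_map.1 hq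
      exact (List.nodup_cons.1 hR).1)
  have hSR : ((t :: (l' ++ [u])).filter (· ∈ S)).toFinset = S := by
    ext x
    simp only [List.mem_toFinset, List.mem_filter, decide_eq_true_eq]
    exact ⟨fun h => h.2, fun h => ⟨hS x h, h⟩⟩
  have hnd : ((t :: (l' ++ [u])).filter (· ∈ S)).Nodup := hR.filter _
  refine ⟨M, hM1, ?_, ?_⟩
  · rw [hM2]
    conv_rhs => rw [← hSR, List.sum_toFinset _ hnd, List.filter_cons_of_pos (by simpa using ht)]
    rw [List.map_cons, List.sum_cons]
    have : (∑ w, pathEdges ((Q w).reverse.map (Prod.mk t))) =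
        fibreCopy (edges (Finset.univ.val.map Q)) t := by
      rw [fibreCopy, map_edges, Multiset.map_map, edges_map]
      refine Finset.sum_congr rfl fun w _ => ?_
      rw [List.map_reverse, pathEdges_reverse, Function.comp_apply]
    rw [this]
    abel
  · have : S.card = (l'.filter (· ∈ S)).length + 2 := by
      conv_lhs => rw [← hSR]
      rw [List.toFinset_card_of_nodup hnd, List.filter_cons_of_pos (by simpa using ht),
        List.filter_append]
      simp [hu]
    rw [this]
    rw [List.dropLast_concat] at hM3
    linarith

/-- `U` holds the vertices whose copies of `H` are still to be covered. The induction hands each of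
them to exactly one path of `F`, so the costs add up to `|U| * n/2`. -/
theorem exists_product_paths (hQ : ∀ w, (Q w).Nodup ∧ (Q w).head? = some w)
    (hfib : ∀ v, {w | (Q w).getLast? = some v}.ncard ≤ 2) (F : Multiset (List V))
    (hF : ∀ R ∈ F, R.Nodup ∧ 2 ≤ R.length) (hF1 : ∀ t, ends F t ≤ 1) (U : Finset V)
    (hU : ∀ t ∈ U, ∃ R ∈ F, t ∈ R) (hends : ∀ t, 0 < ends F t → t ∈ U) :
    ∃ M : Multiset (List (V × W)), (∀ p ∈ M, p.Nodup) ∧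
      edges M = (∑ w, (edges F).map (Sym2.map fun u => (u, w))) +
        ∑ t ∈ U, fibreCopy (edges (Finset.univ.val.map Q)) t ∧
      2 * M.card ≤ Fintype.card W * U.card := by
  induction F using Multiset.induction_on generalizing U with
  | empty =>
    refine ⟨0, by simp, ?_, by simp⟩
    have : U = ∅ := Finset.eq_empty_of_forall_notMem fun t ht => by simpa using hU t ht
    simp [this]
  | cons R F ih =>
  simp only [ends_cons] at hF1 hends
  -- `R` takes its vertices in `U`, except those reserved for a later path that ends there. Its own
  -- ends are not reserved, since at most one path ends at a vertex.
  set S := U.filter fun t => t ∈ R ∧ ends F t = 0 with hS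
  obtain ⟨M₁, h1, h2, h3⟩ := exists_strands hQ hfib R (hF R (by simp)).1 (hF R (by simp)).2 S
    (fun t ht => (Finset.mem_filter.1 ht).2.1)
    (fun t ht => Finset.mem_filter.2 ⟨hends t (by omega), mem_of_endCount_pos ht, by
      have := hF1 t
      omega⟩)
  obtain ⟨M₂, h4, h5, h6⟩ := ih (fun R' hR' => hF R' (by simp [hR']))
    (fun t => (Nat.le_add_left _ _).trans (hF1 t)) (U \ S)
    (by
      intro t ht
      rw [Finset.mem_sdiff, hS, Finset.mem_filter] at ht
      by_cases h0 : ends F t = 0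
      · obtain ⟨R', hR', htR⟩ := hU t ht.1
        rcases Multiset.mem_cons.1 hR' with rfl | hR'
        · exact absurd ⟨ht.1, htR, h0⟩ ht.2
        · exact ⟨R', hR', htR⟩
      · obtain ⟨R', hR', htR⟩ := exists_of_ends_pos (Nat.pos_of_ne_zero h0)
        exact ⟨R', hR', mem_of_endCount_pos htR⟩)
    (by
      intro t ht
      rw [Finset.mem_sdiff, hS, Finset.mem_filter]
      exact ⟨hends t (by omega), fun h => by omega⟩)
  have hSU : S ⊆ U := Finset.filter_subset _ _
  refine ⟨M₁ + M₂, ?_, ?_, ?_⟩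
  · intro p hp
    rcases Multiset.mem_add.1 hp with hp | hp
    · exact h1 p hp
    · exact h4 p hp
  · rw [edges_add, h2, h5, ← Finset.sum_sdiff hSU]
    simp only [edges_cons, Multiset.map_add, pathEdges_map, Finset.sum_add_distrib]
    abel
  · rw [Multiset.card_add, ← Finset.card_sdiff_add_card_eq_card hSU]
    linarith

end Strands

/-! ### Path decompositions of forests -/

open SimpleGraph

/-- The first vertex of a longest path: a neighbour off the path would extend it, and one on the
path other than its second vertex would close a cycle. -/
theorem exists_leaf [Finite V] {G : SimpleGraph V} (hG : G.IsAcyclic) {a b : V} (hab : G.Adj a b) :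
    ∃ u v, G.Adj u v ∧ ∀ x, G.Adj u x → x = v := by
  have : Nonempty V := ⟨a⟩
  have := Fintype.ofFinite G.edgeSet
  obtain ⟨u, v, p, hp, hmax⟩ := Walk.exists_isPath_forall_isPath_length_le_length G
  have hnil : ¬ p.Nil := by
    intro h
    have h1 := hmax a b hab.toWalk (Walk.IsPath.of_adj hab)
    rw [Walk.length_eq_zero_iff.2 h] at h1
    simp at h1
  refine ⟨u, p.snd, p.adj_snd hnil, fun x hx => hG.eq_snd_of_adj_start hp hx ?_⟩
  by_contra hns
  have h1 := hmax _ _ _ (hp.cons (h := hx.symm) hns)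
  rw [Walk.length_cons] at h1
  omega

/-- A finite forest decomposes into nontrivial paths, at most one of them ending at each vertex. -/
theorem exists_forest_paths [Fintype V] [DecidableEq V] (G : SimpleGraph V) (hG : G.IsAcyclic)
    (E : Finset (Sym2 V)) (hE : ∀ e, e ∈ E ↔ e ∈ G.edgeSet) :
    ∃ F : Multiset (List V), (∀ R ∈ F, R.Nodup ∧ 2 ≤ R.length) ∧ edges F = E.val ∧
      ∀ t, ends F t ≤ 1 := by
  induction hn : E.card generalizing G E with
  | zero =>
    rw [Finset.card_eq_zero] at hn
    subst hn
    exact ⟨0, by simp, by simp, by simp⟩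
  | succ n ih =>
  obtain ⟨e, he⟩ := Finset.card_pos.1 (by omega : 0 < E.card)
  induction e with
  | _ a b =>
  obtain ⟨u, v, huv, huniq⟩ := exists_leaf hG ((hE _).1 he : G.Adj a b)
  have huvE : s(u, v) ∈ E := (hE _).2 huv
  have hne : u ≠ v := huv.ne
  obtain ⟨F, hF, hFE, hF1⟩ := ih (G.deleteEdges {s(u, v)})
    (hG.anti (G.deleteEdges_le _)) (E.erase s(u, v))
    (by
      intro e
      rw [Finset.mem_erase, hE, edgeSet_deleteEdges]
      simp [and_comm])
    (by rw [Finset.card_erase_of_mem huvE, hn]; rfl)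
  have hu : ∀ R ∈ F, u ∉ R := by
    intro R hR huR
    obtain ⟨e, heR, hue⟩ := exists_mem_pathEdges R huR (by
      rintro rfl
      simpa using (hF _ hR).2)
    have heE : e ∈ edges F := mem_edges.2 ⟨R, hR, heR⟩
    rw [hFE, Finset.mem_val, Finset.mem_erase, hE] at heE
    obtain ⟨x, rfl⟩ := hue
    exact heE.1 (by rw [huniq x heE.2])
  have hu0 : ends F u = 0 := by
    by_contra h
    obtain ⟨R, hR, hRu⟩ := exists_of_ends_pos (Nat.pos_of_ne_zero h)
    exact hu R hR (mem_of_endCount_pos hRu)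
  have hEval : E.val = s(u, v) ::ₘ (E.erase s(u, v)).val := by
    rw [← Finset.insert_val_of_notMem (by simp), Finset.insert_erase huvE]
  -- Put back the edge from the leaf `u` to `v`: as a new path if no path ends at `v`, otherwise by
  -- prolonging the path ending at `v`. Either way `v` has at most one end, and `u` was on no path
  -- before.
  by_cases hv : ends F v = 0
  · refine ⟨[u, v] ::ₘ F, ?_, ?_, ?_⟩
    · intro R hR
      rcases Multiset.mem_cons.1 hR with rfl | hR
      · simp [hne]
      · exact hF R hR
    · rw [edges_cons, hFE, hEval]
      simp
    · intro t
      have := hF1 t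
      rw [ends_cons, endCount]
      simp only [List.head?_cons, List.getLast?_cons_cons, List.getLast?_singleton,
        Option.some.injEq]
      by_cases htu : u = t
      · subst htu
        simp [hu0, hne.symm]
      · by_cases htv : v = t
        · subst htv
          simp [hv, hne]
        · simpa [htu, htv] using this
  · obtain ⟨R, hR, hRv⟩ := exists_of_ends_pos (Nat.pos_of_ne_zero hv)
    obtain ⟨F₀, rfl⟩ := Multiset.exists_cons_of_mem hR
    obtain ⟨r, hr⟩ := head?_or_reverse_of_endCount_pos hRv
    have hpe : pathEdges R = pathEdges (v :: r) := by
      rcases hr with h | h <;> rw [← h]; simp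
    have hec : ∀ t, endCount t R = endCount t (v :: r) := by
      intro t
      rcases hr with h | h <;> rw [← h]; simp
    have hnd : (v :: r).Nodup := by
      rcases hr with h | h <;> rw [← h]
      · exact (hF R hR).1
      · exact List.nodup_reverse.2 (hF R hR).1
    have humem : u ∉ v :: r := by
      rcases hr with h | h <;> rw [← h]
      · exact hu R hR
      · simpa using hu R hR
    refine ⟨(u :: v :: r) ::ₘ F₀, ?_, ?_, ?_⟩
    · intro R' hR'
      rcases Multiset.mem_cons.1 hR' with rfl | hR'
      · exact ⟨List.nodup_cons.2 ⟨humem, hnd⟩, by simp⟩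
      · exact hF R' (by simp [hR'])
    · rw [edges_cons, hpe] at hFE
      rw [edges_cons, pathEdges_cons_cons, Multiset.cons_add, hFE, hEval]
    · intro t
      have := hF1 t
      rw [ends_cons, hec, endCount] at this
      rw [ends_cons, hec, endCount] at hu0
      rw [ends_cons, endCount, List.getLast?_cons_cons]
      simp only [List.head?_cons, Option.some.injEq] at this hu0 ⊢
      by_cases htu : u = t
      · subst htu
        rw [if_pos rfl]
        omega
      · rw [if_neg htu]
        omega

/-! ### From vertex lists to path decompositions -/

theorem edges_eq_pathEdges_support {G : SimpleGraph X} {u v : X} (p : G.Walk u v) :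
    (p.edges : Multiset (Sym2 X)) = pathEdges p.support := by
  induction p with
  | nil => rfl
  | @cons a b c h p ih =>
    cases p with
    | nil => rfl
    | cons h' p =>
      simp only [Walk.edges_cons, Walk.support_cons, pathEdges_cons_cons, ← Multiset.cons_coe] at ih ⊢
      rw [ih]

theorem isChain_of_pathEdges {G : SimpleGraph X} {l : List X}
    (h : ∀ e ∈ pathEdges l, e ∈ G.edgeSet) : l.IsChain G.Adj := by
  induction l with
  | nil => exact .nil
  | cons a l ih =>
    cases l with
    | nil => exact .singleton a
    | cons b l =>
      refine List.IsChain.cons_cons (h s(a, b) (by simp)) (ih fun e he => h e ?_)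
      exact Multiset.mem_cons_of_mem he

theorem pathDecompositionNumber_le_card (G : SimpleGraph X) (M : Multiset (List X))
    (hM : ∀ p ∈ M, p.Nodup) (hnd : (edges M).Nodup) (hmem : ∀ e, e ∈ edges M ↔ e ∈ G.edgeSet) :
    G.pathDecompositionNumber ≤ M.card := by
  classical
  have hsub : ∀ l, ∃ P : G.Subgraph, l ∈ M → l ≠ [] →
      P.IsPathGraph ∧ ∀ e, e ∈ P.edgeSet ↔ e ∈ pathEdges l := by
    intro l
    by_cases hl : l ∈ M ∧ l ≠ []
    · have hchain : l.IsChain G.Adj := isChain_of_pathEdges fun e he =>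
        (hmem e).1 (mem_edges.2 ⟨l, hl.1, he⟩)
      refine ⟨(Walk.ofSupport l hl.2 hchain).toSubgraph, fun _ _ => ⟨⟨_, _, _, ?_, rfl⟩, ?_⟩⟩
      · rw [Walk.isPath_def, Walk.support_ofSupport]
        exact hM l hl.1
      · intro e
        rw [Walk.mem_edges_toSubgraph, ← Multiset.mem_coe, edges_eq_pathEdges_support,
          Walk.support_ofSupport]
    · exact ⟨⊥, fun h1 h2 => absurd ⟨h1, h2⟩ hl⟩
  choose P hP using hsub
  -- Empty lists are not walks and carry no edges, so they are dropped.
  have hD : G.IsPathDecomposition ((M.toFinset.filter (· ≠ [])).image P) := by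
    refine ⟨?_, ?_, ?_⟩
    · intro A hA
      obtain ⟨l, hl, rfl⟩ := Finset.mem_image.1 hA
      rw [Finset.mem_filter, Multiset.mem_toFinset] at hl
      exact (hP l hl.1 hl.2).1
    · intro A hA B hB hAB
      obtain ⟨l, hl, rfl⟩ := Finset.mem_image.1 hA
      obtain ⟨l', hl', rfl⟩ := Finset.mem_image.1 hB
      rw [Finset.mem_filter, Multiset.mem_toFinset] at hl hl'
      have hne : l' ≠ l := fun h => hAB (by rw [h])
      obtain ⟨N, rfl⟩ := Multiset.exists_cons_of_mem hl.1
      have hN : l' ∈ N := (Multiset.mem_cons.1 hl'.1).resolve_left hne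
      rw [edges_cons, Multiset.nodup_add] at hnd
      rw [Set.disjoint_left]
      intro e he he'
      rw [(hP l hl.1 hl.2).2] at he
      rw [(hP l' hl'.1 hl'.2).2] at he'
      exact Multiset.disjoint_left.1 hnd.2.2 he (mem_edges.2 ⟨l', hN, he'⟩)
    · intro e he
      obtain ⟨l, hl, hel⟩ := mem_edges.1 ((hmem e).2 he)
      have hne : l ≠ [] := by rintro rfl; simp at hel
      refine ⟨P l, Finset.mem_image_of_mem _ (Finset.mem_filter.2 ⟨Multiset.mem_toFinset.2 hl, hne⟩),
        ((hP l hl hne).2 e).2 hel⟩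
  have hle : G.pathDecompositionNumber ≤ ((M.toFinset.filter (· ≠ [])).image P).card :=
    Nat.sInf_le ⟨_, hD, rfl⟩
  exact hle.trans (Finset.card_image_le.trans
    ((Finset.card_filter_le _ _).trans (Multiset.toFinset_card_le M)))

/-! ### Edges of the Cartesian product -/

section BoxProd

variable [Fintype V] [Fintype W]

theorem mem_boxProd_edges {T : SimpleGraph V} {H : SimpleGraph W} {A : Finset (Sym2 V)}
    {B : Finset (Sym2 W)} (hA : ∀ e, e ∈ A ↔ e ∈ T.edgeSet) (hB : ∀ e, e ∈ B ↔ e ∈ H.edgeSet)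
    (e : Sym2 (V × W)) :
    e ∈ (∑ w, A.val.map (Sym2.map fun u => (u, w))) + ∑ t, fibreCopy B.val t ↔
      e ∈ (T.boxProd H).edgeSet := by
  rw [Multiset.mem_add, Multiset.mem_sum, Multiset.mem_sum]
  induction e with
  | _ p q =>
  obtain ⟨t, w⟩ := p
  obtain ⟨t', w'⟩ := q
  rw [mem_edgeSet, boxProd_adj]
  refine or_congr ?_ ?_
  · simp only [Finset.mem_univ, true_and, Multiset.mem_map, Finset.mem_val, hA]
    constructor
    · rintro ⟨x, e, he, h⟩
      induction e with
      | _ a b =>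
      rw [Sym2.map_mk, Sym2.eq_iff] at h
      simp only [Prod.mk.injEq] at h
      rcases h with ⟨⟨rfl, rfl⟩, rfl, rfl⟩ | ⟨⟨rfl, rfl⟩, rfl, rfl⟩
      · exact ⟨he, rfl⟩
      · exact ⟨he.symm, rfl⟩
    · rintro ⟨h, rfl : w = w'⟩
      exact ⟨w, s(t, t'), h, rfl⟩
  · simp only [Finset.mem_univ, true_and, fibreCopy, Multiset.mem_map, Finset.mem_val, hB]
    constructor
    · rintro ⟨x, e, he, h⟩
      induction e with
      | _ a b =>
      rw [Sym2.map_mk, Sym2.eq_iff] at h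
      simp only [Prod.mk.injEq] at h
      rcases h with ⟨⟨rfl, rfl⟩, rfl, rfl⟩ | ⟨⟨rfl, rfl⟩, rfl, rfl⟩
      · exact ⟨he, rfl⟩
      · exact ⟨he.symm, rfl⟩
    · rintro ⟨h, rfl : t = t'⟩
      exact ⟨t, s(w, w'), h, rfl⟩

theorem nodup_sum_of_fibres {ι α : Type*} [Fintype ι] (f : ι → Multiset (Sym2 α)) (g : α → ι)
    (hf : ∀ i, (f i).Nodup) (hg : ∀ i, ∀ e ∈ f i, ∀ x ∈ e, g x = i) : (∑ i, f i).Nodup := by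
  have h : (∑ i, f i) = Finset.univ.val.bind f := rfl
  rw [h, Multiset.nodup_bind]
  refine ⟨fun i _ => hf i, ?_⟩
  refine (Finset.univ.nodup.pairwise ?_)
  intro i _ j _ hij
  rw [Function.onFun, Multiset.disjoint_left]
  intro e he he'
  induction e with
  | _ x y => exact hij ((hg i _ he x (by simp)).symm.trans (hg j _ he' x (by simp)))

/-- An edge determines the copy containing it. One lying both in a copy of `A` and in a copy of `B`
would have equal first coordinates, hence come from a loop in `A`. -/
theorem nodup_boxProd_edges (A : Finset (Sym2 V)) (hA : ∀ e ∈ A, ¬ e.IsDiag)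
    (B : Finset (Sym2 W)) :
    ((∑ w : W, A.val.map (Sym2.map fun u => (u, w))) + ∑ t : V, fibreCopy B.val t).Nodup := by
  have h1 : ∀ w : W, ∀ e ∈ A.val.map (Sym2.map fun u => (u, w)), ∀ x ∈ e, x.2 = w := by
    intro w e he x hx
    obtain ⟨e', -, rfl⟩ := Multiset.mem_map.1 he
    obtain ⟨y, -, rfl⟩ := Sym2.mem_map.1 hx
    rfl
  have h2 : ∀ t : V, ∀ e ∈ fibreCopy B.val t, ∀ x ∈ e, x.1 = t := by
    intro t e he x hx
    obtain ⟨e', -, rfl⟩ := Multiset.mem_map.1 he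
    obtain ⟨y, -, rfl⟩ := Sym2.mem_map.1 hx
    rfl
  rw [Multiset.nodup_add]
  refine ⟨nodup_sum_of_fibres _ Prod.snd (fun w => ?_) h1,
    nodup_sum_of_fibres _ Prod.fst (fun t => ?_) h2, ?_⟩
  · exact A.nodup.map (Sym2.map.injective (Prod.mk_left_injective w))
  · exact B.nodup.map (Sym2.map.injective (Prod.mk_right_injective t))
  · rw [Multiset.disjoint_left]
    intro e he he'
    rw [Multiset.mem_sum] at he he'
    obtain ⟨w, -, he⟩ := he
    obtain ⟨t, -, he'⟩ := he'
    obtain ⟨e, heA, rfl⟩ := Multiset.mem_map.1 he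
    induction e with
    | _ a b =>
    refine hA _ heA ?_
    rw [Sym2.map_mk] at he'
    have ha := h2 t _ he' (a, w) (by simp)
    have hb := h2 t _ he' (b, w) (by simp)
    exact Sym2.mk_isDiag_iff.2 (ha.trans hb.symm)

end BoxProd

end PathFamily

/-! ### The bound for the product -/

theorem corollary4p4 {V W : Type*} [Fintype V] [Fintype W]
    (T : SimpleGraph V) (H : SimpleGraph W) (m n : ℕ)
    (hT : T.IsTree) (hm : Fintype.card V = m) (hm2 : 2 ≤ m)
    (hH : H.Connected) (hn : Fintype.card W = n) :
    ((T.boxProd H).pathDecompositionNumber : ℚ) ≤ (m : ℚ) * (n : ℚ) / 2 := by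
  classical
  obtain ⟨Q, hQ, hQE, hfib⟩ := PathFamily.exists_rooted_paths H.edgeFinset
    (fun e he => H.not_isDiag_of_mem_edgeSet (SimpleGraph.mem_edgeFinset.1 he))
  obtain ⟨F, hF, hFE, hF1⟩ := PathFamily.exists_forest_paths T hT.isAcyclic T.edgeFinset
    (fun e => SimpleGraph.mem_edgeFinset)
  -- With at least two vertices the tree has no isolated vertex, so every vertex lies on a path of
  -- `F` and can be charged to it.
  have : Nontrivial V := Fintype.one_lt_card_iff_nontrivial.1 (by omega)
  obtain ⟨M, hM, hME, hMc⟩ := PathFamily.exists_product_paths hQ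
    (fun v => by
      refine le_trans (le_of_eq ?_) (hfib v)
      rw [← Set.ncard_coe_finset]
      simp)
    F hF hF1 Finset.univ
    (by
      intro t _
      obtain ⟨u, hu⟩ := hT.connected.preconnected.exists_adj_of_nontrivial t
      have he : s(t, u) ∈ PathFamily.edges F := by
        rw [hFE]
        exact SimpleGraph.mem_edgeFinset.2 hu
      obtain ⟨R, hR, heR⟩ := PathFamily.mem_edges.1 he
      exact ⟨R, hR, PathFamily.mem_of_mem_pathEdges heR (by simp)⟩)
    (fun t _ => Finset.mem_univ t)
  rw [hFE, hQE] at hME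
  have hle := PathFamily.pathDecompositionNumber_le_card (T.boxProd H) M hM
    (by
      rw [hME]
      exact PathFamily.nodup_boxProd_edges _
        (fun e he => T.not_isDiag_of_mem_edgeSet (SimpleGraph.mem_edgeFinset.1 he)) _)
    (by
      intro e
      rw [hME]
      exact PathFamily.mem_boxProd_edges (fun e => SimpleGraph.mem_edgeFinset)
        (fun e => SimpleGraph.mem_edgeFinset) e)
  rw [Finset.card_univ, hm, hn] at hMc
  have h2 : 2 * (T.boxProd H).pathDecompositionNumber ≤ m * n := by
    rw [mul_comm m n]
    omega
  have h3 : (2 : ℚ) * ((T.boxProd H).pathDecompositionNumber : ℚ) ≤ (m : ℚ) * n := by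
    exact_mod_cast h2
  linarith
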